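/- Let $\mathcal T=(T_t)_{t\in\mathbb R}$ be an ergodic, aperiodic, (jointly) measurable flow preserving the probability measure $\mu$ of a standard Borel probability space $(X,\mathcal B,\mu)$; aperiodic means that $\mu\{x: T_tx=x\}=0$ for every $t\neq0$. The flow is isomorphic to its inverse if there is an automorphism $S$ of $(X,\mathcal B,\mu)$ with $S\circ T_t=T_{-t}\circ S$ ($\mu$-a.e.) for each $t\in\mathbb R$, and it is reversible if moreover $S$ can be chosen with $S^2=\mathrm{Id}$. For $k\ge 1$ and $t_1,\dots,t_{k-1}\in\mathbb R$ let $\mu_{T_{t_1},\dots,T_{t_{k-1}}}$ be the image of $\mu$ under $x\mapsto(T_{t_1}x,\dots,T_{t_{k-1}}x,x)$. This is a $k$-self-joining, that is, a probability measure on $X^k$, invariant under $T_t\times\dots\times T_t$ for all $t$, all of whose one-dimensional marginals are $\mu$. Integrals of such joinings are defined by integrating the measure of each set. The set of $k$-self-joinings carries the topology of the metric $$d(\lambda,\lambda')=\sum_{n_1,\dots,n_k\in\mathbb N}2^{-(n_1+\dots+n_k)}\bigl|\lambda(B_{n_1}\times\dots\times B_{n_k})-\lambda'(B_{n_1}\times\dots\times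 B_{n_k})\bigr|,$$ where $\{B_n\}$ is a fixed countable family of measurable sets which is dense for the pseudometric $\mu(A\triangle B)$. (1) Let $d\ge1$ and $\{0,1\}^{\prime d}=\{0,1\}^d\setminus\{(0,\dots,0)\}$. For $\bar t\in\mathbb R^{\{0,1\}^{\prime d}}$ put $\bar t_{(0,\dots,0)}=0$ and let $\mu_{\bar t}$ be the image of $\mu$ under $x\mapsto(T_{\bar t_{\bar\varepsilon}}x)_{\bar\varepsilon\in\{0,1\}^d}$. For $\bar q=(q^0,\dots,q^{d-1})\in\mathbb R^d$ put $\bar q(\bar\varepsilon)=\sum_i\varepsilon_iq^i$. Suppose that for some sequence $(\bar q_n)$ in $\mathbb R^d$ and some Borel probability measure $Q$ on $\mathbb R^{\{0,1\}^{\prime d}}$ $$\mu_{(\bar q_n(\bar\varepsilon))_{\bar\varepsilon\in\{0,1\}^{\prime d}}}\to\int\mu_{-\bar t}\,dQ(\bar t)$$ in the space of $2^d$-self-joinings. If $Q$ is not invariant under the map $$\bar\theta(\bar t)=\bigl(\bar t_{(1,\dots,1)}-\bar t_{(1-\varepsilon_0,\dots,1-\varepsilon_{d-1})}\bigr)_{\bar\varepsilon\in\{0,1\}^{\prime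 d}},$$ then $\mathcal T$ is not isomorphic to its inverse; in particular $\mathcal T$ is not reversible. (2) Let $d\ge1$, let $(q_n)$ be a sequence of real numbers and $P$ a Borel probability measure on $\mathbb R^d$ with $$\mu_{T_{dq_n},T_{(d-1)q_n},\dots,T_{q_n}}\to\int_{\mathbb R^d}\mu_{T_{-t_0},\dots,T_{-t_{d-1}}}\,dP(t_0,\dots,t_{d-1})$$ in the space of $(d+1)$-self-joinings. If $P$ is not invariant under $\theta(t_0,t_1,\dots,t_{d-1})=(t_0,t_0-t_{d-1},\dots,t_0-t_1)$, then $\mathcal T$ is not isomorphic to its inverse. (3) Let $(q_n)$ be a sequence of real numbers and $Q$ a Borel probability measure on $\mathbb R^2$ with $$\mu_{T_{2q_n},T_{q_n}}\to\int_{\mathbb R^2}\mu_{T_{-t},T_{-u}}\,dQ(t,u)$$ in the space of $3$-self-joinings. If $Q$ is not invariant under $(t,u)\mapsto(t,t-u)$, then $\mathcal T$ is not isomorphic to its inverse. In particular, if for some $x\in\mathbb R$ the point $(0,x)$ is an atom of $Q$ and $(0,-x)$ is not, then $\mathcal T$ is not isomorphic to its inverse. -/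

import Mathlib

open MeasureTheory Filter Topology

namespace FlowJoinings

noncomputable section

/-! A flow `(T_t)` on `(X, μ)` is a jointly measurable, `μ`-preserving action of `(ℝ, +)` on `X`;
the time-`t` map is `T_t x = t +ᵥ x`. -/

/-- The flow is aperiodic: for each `t ≠ 0` almost no point is fixed by `T_t`. -/
def Aperiodic {X : Type*} [MeasurableSpace X] [AddAction ℝ X] (μ : Measure X) : Prop :=
  ∀ t : ℝ, t ≠ 0 → μ {x : X | t +ᵥ x = x} = 0

/-- `S` is an automorphism of the measure space `(X, μ)`, i.e. a measure-preserving map which is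
invertible modulo null sets, and `S ∘ T_t = T_{-t} ∘ S` modulo null sets for each `t`. -/
def ConjugatesToInverse {X : Type*} [MeasurableSpace X] [AddAction ℝ X] (μ : Measure X)
    (S : X → X) : Prop :=
  MeasurePreserving S μ μ ∧
  (∃ R : X → X, MeasurePreserving R μ μ ∧ (∀ᵐ x ∂μ, R (S x) = x) ∧ (∀ᵐ x ∂μ, S (R x) = x)) ∧
  ∀ t : ℝ, ∀ᵐ x ∂μ, S (t +ᵥ x) = (-t) +ᵥ S x

/-- The flow `(T_t)` is isomorphic to its inverse `(T_{-t})`. -/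
def IsomorphicToInverse {X : Type*} [MeasurableSpace X] [AddAction ℝ X] (μ : Measure X) : Prop :=
  ∃ S : X → X, ConjugatesToInverse μ S

/-- The flow is reversible: it is isomorphic to its inverse through an involution. -/
def Reversible {X : Type*} [MeasurableSpace X] [AddAction ℝ X] (μ : Measure X) : Prop :=
  ∃ S : X → X, ConjugatesToInverse μ S ∧ ∀ᵐ x ∂μ, S (S x) = x

/-- Self-joinings of the flow, with coordinates indexed by `ι`: probability measures on `ι → X`
invariant under the diagonal flow `T_t × ⋯ × T_t`, all of whose marginals are `μ`. -/
structure IsSelfJoining {X : Type*} [MeasurableSpace X] [AddAction ℝ X] (μ : Measure X)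
    {ι : Type*} (ρ : Measure (ι → X)) : Prop where
  isProbabilityMeasure : IsProbabilityMeasure ρ
  invariant : ∀ t : ℝ, MeasurePreserving (fun (x : ι → X) i => t +ᵥ x i) ρ ρ
  marginal : ∀ i : ι, ρ.map (fun x => x i) = μ

/-- The metric
`∑_n 2 ^ (-∑_i n_i) |ρ(∏_i B_{n_i}) - ρ'(∏_i B_{n_i})|`, `n` ranging over `ι → ℕ`,
on self-joinings, associated with a countable family `B` of measurable sets. A sum of
nonnegative terms, it is taken in `[0, ∞]`, which avoids any default value. -/
def joiningDist {X : Type*} [MeasurableSpace X] {ι : Type*} [Fintype ι] (B : ℕ → Set X)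
    (ρ ρ' : Measure (ι → X)) : ENNReal :=
  ∑' n : ι → ℕ, ENNReal.ofReal ((1 / 2 : ℝ) ^ (∑ i, n i) *
    |ρ.real (Set.univ.pi fun i => B (n i)) - ρ'.real (Set.univ.pi fun i => B (n i))|)

/-- The off-diagonal self-joining given by the maps `(T_{s_i})_{i ∈ ι}`: the image of `μ` under
`x ↦ (T_{s_i} x)_{i ∈ ι}`. -/
def offDiagonal {X : Type*} [MeasurableSpace X] [AddAction ℝ X] (μ : Measure X)
    {ι : Type*} (s : ι → ℝ) : Measure (ι → X) :=
  μ.map fun x i => s i +ᵥ x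

/-- The integral of off-diagonal joinings, `A ↦ ∫ (offDiagonal μ (s t)) A dP(t)`. -/
def offDiagonalIntegral {X : Type*} [MeasurableSpace X] [AddAction ℝ X] (μ : Measure X)
    {ι Ω : Type*} [MeasurableSpace Ω] (P : Measure Ω) (s : Ω → ι → ℝ) : Measure (ι → X) :=
  P.bind fun t => offDiagonal μ (s t)

/-- The cube `{0,1}^d`, with `true` for `1` and `false` for `0`. -/
abbrev Cube (d : ℕ) : Type := Fin d → Bool

/-- The cube without its zero vertex. -/
abbrev PuncturedCube (d : ℕ) : Type := {ε : Cube d // ε ≠ fun _ => false}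

/-- Extend a vector indexed by the punctured cube by `0` at the vertex `(0, …, 0)`. -/
def extendZero {d : ℕ} (t : PuncturedCube d → ℝ) : Cube d → ℝ :=
  fun ε => if h : ε ≠ fun _ => false then t ⟨ε, h⟩ else 0

/-- The finite sums `q(ε) = ∑_i ε_i q_i`. -/
def finiteSums {d : ℕ} (q : Fin d → ℝ) : PuncturedCube d → ℝ :=
  fun ε => ∑ i, if ε.1 i then q i else 0

/-- The map `t ↦ (t_{(1,…,1)} - t_{(1-ε_0,…,1-ε_{d-1})})_ε`, where `t_{(0,…,0)} = 0`. -/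
def thetaBar {d : ℕ} (t : PuncturedCube d → ℝ) : PuncturedCube d → ℝ :=
  fun ε => extendZero t (fun _ => true) - extendZero t (fun i => !ε.1 i)

/-- The map `(t_0, …, t_{d-1}) ↦ (t_0, t_0 - t_{d-1}, …, t_0 - t_1)`. -/
def theta {d : ℕ} (t : Fin d → ℝ) : Fin d → ℝ :=
  fun j => if h : (j : ℕ) = 0 then t j else t ⟨0, by omega⟩ - t ⟨d - j, by omega⟩

/-- The vector `(t_0, …, t_{d-1}, 0)`. -/
def appendZero {d : ℕ} (t : Fin d → ℝ) : Fin (d + 1) → ℝ :=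
  Fin.snoc (α := fun _ => ℝ) t 0

/-! Basic facts showing that the maps above are measurable and that the measures above are
self-joinings with the expected values. -/

theorem measurable_extendZero {d : ℕ} : Measurable (extendZero (d := d)) := by
  refine measurable_pi_lambda _ fun ε => ?_
  by_cases h : ε ≠ fun _ => false
  · simpa [extendZero, h] using measurable_pi_apply (X := fun _ => ℝ) (⟨ε, h⟩ : PuncturedCube d)
  · simp [extendZero, h]

theorem measurable_thetaBar {d : ℕ} : Measurable (thetaBar (d := d)) :=
  measurable_pi_lambda _ fun ε =>
    (measurable_pi_iff.1 measurable_extendZero fun _ => true).sub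
      (measurable_pi_iff.1 measurable_extendZero fun i => !ε.1 i)

theorem measurable_theta {d : ℕ} : Measurable (theta (d := d)) := by
  refine measurable_pi_lambda _ fun j => ?_
  by_cases h : (j : ℕ) = 0
  · simpa [theta, h] using measurable_pi_apply (X := fun _ => ℝ) j
  · simp only [theta, h, dite_false]
    exact (measurable_pi_apply (X := fun _ => ℝ) _).sub (measurable_pi_apply (X := fun _ => ℝ) _)

theorem measurable_appendZero {d : ℕ} : Measurable (appendZero (d := d)) := by
  refine measurable_pi_lambda _ fun j => ?_
  induction j using Fin.lastCases with
  | last => simp [appendZero]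
  | cast j => simpa [appendZero] using measurable_pi_apply (X := fun _ => ℝ) j

theorem offDiagonal_pi {X : Type*} [MeasurableSpace X] [AddAction ℝ X] [MeasurableVAdd₂ ℝ X]
    (μ : Measure X) {ι : Type*} [Countable ι] (s : ι → ℝ) (A : ι → Set X)
    (hA : ∀ i, MeasurableSet (A i)) :
    offDiagonal μ s (Set.univ.pi A) = μ (⋂ i, (fun x => s i +ᵥ x) ⁻¹' A i) := by
  rw [offDiagonal, Measure.map_apply (measurable_pi_lambda _ fun i => measurable_const_vadd (s i))
    (MeasurableSet.univ_pi hA)]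
  congr 1
  ext x
  simp

theorem isSelfJoining_offDiagonal {X : Type*} [MeasurableSpace X] [AddAction ℝ X]
    [MeasurableVAdd₂ ℝ X] (μ : Measure X) [IsProbabilityMeasure μ] [VAddInvariantMeasure ℝ X μ]
    {ι : Type*} (s : ι → ℝ) : IsSelfJoining μ (offDiagonal μ s) := by
  have hm : Measurable fun (x : X) (i : ι) => s i +ᵥ x :=
    measurable_pi_lambda _ fun i => measurable_const_vadd (s i)
  have hd : ∀ t : ℝ, Measurable fun (x : ι → X) i => t +ᵥ x i := fun t =>
    measurable_pi_lambda _ fun i => (measurable_const_vadd t).comp (measurable_pi_apply i)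
  refine ⟨Measure.isProbabilityMeasure_map hm.aemeasurable, fun t => ⟨hd t, ?_⟩, fun i => ?_⟩
  · rw [offDiagonal, Measure.map_map (hd t) hm]
    conv_rhs => rw [← (measurePreserving_vadd t μ).map_eq,
      Measure.map_map hm (measurable_const_vadd t)]
    congr 1
    funext x i
    simp only [Function.comp_apply, vadd_vadd, add_comm]
  · rw [offDiagonal, Measure.map_map (measurable_pi_apply i) hm]
    exact (measurePreserving_vadd (s i) μ).map_eq

theorem measurable_offDiagonal {X : Type*} [MeasurableSpace X] [AddAction ℝ X]
    [MeasurableVAdd₂ ℝ X] (μ : Measure X) [SFinite μ] {ι Ω : Type*} [MeasurableSpace Ω]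
    {s : Ω → ι → ℝ} (hs : Measurable s) : Measurable fun t => offDiagonal μ (s t) := by
  have hj : Measurable fun p : Ω × X => fun i => s p.1 i +ᵥ p.2 :=
    measurable_pi_lambda _ fun i =>
      (((measurable_pi_apply i).comp hs).comp measurable_fst).vadd measurable_snd
  refine Measure.measurable_of_measurable_coe _ fun A hA => ?_
  have h : ∀ t, offDiagonal μ (s t) A =
      μ (Prod.mk t ⁻¹' ((fun p : Ω × X => fun i => s p.1 i +ᵥ p.2) ⁻¹' A)) := fun t => by
    exact Measure.map_apply (hj.comp measurable_prodMk_left) hA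
  simp_rw [h]
  exact measurable_measure_prodMk_left (hj hA)

theorem offDiagonalIntegral_apply {X : Type*} [MeasurableSpace X] [AddAction ℝ X]
    [MeasurableVAdd₂ ℝ X] (μ : Measure X) [SFinite μ] {ι Ω : Type*} [MeasurableSpace Ω]
    (P : Measure Ω) {s : Ω → ι → ℝ} (hs : Measurable s) {A : Set (ι → X)} (hA : MeasurableSet A) :
    offDiagonalIntegral μ P s A = ∫⁻ t, offDiagonal μ (s t) A ∂P :=
  Measure.bind_apply hA (measurable_offDiagonal μ hs).aemeasurable

theorem isSelfJoining_offDiagonalIntegral {X : Type*} [MeasurableSpace X] [AddAction ℝ X]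
    [MeasurableVAdd₂ ℝ X] (μ : Measure X) [IsProbabilityMeasure μ] [VAddInvariantMeasure ℝ X μ]
    {ι Ω : Type*} [MeasurableSpace Ω] (P : Measure Ω) [IsProbabilityMeasure P]
    {s : Ω → ι → ℝ} (hs : Measurable s) : IsSelfJoining μ (offDiagonalIntegral μ P s) := by
  have hd : ∀ t : ℝ, Measurable fun (x : ι → X) i => t +ᵥ x i := fun t =>
    measurable_pi_lambda _ fun i => (measurable_const_vadd t).comp (measurable_pi_apply i)
  have hJ := fun t => isSelfJoining_offDiagonal μ (s t)
  refine ⟨⟨?_⟩, fun t => ⟨hd t, ?_⟩, fun i => ?_⟩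
  · rw [offDiagonalIntegral_apply μ P hs .univ]
    simp [fun t => (hJ t).isProbabilityMeasure.measure_univ]
  · ext A hA
    rw [Measure.map_apply (hd t) hA, offDiagonalIntegral_apply μ P hs (hd t hA),
      offDiagonalIntegral_apply μ P hs hA]
    exact lintegral_congr fun r => ((hJ r).invariant t).measure_preimage hA.nullMeasurableSet
  · ext A hA
    rw [Measure.map_apply (measurable_pi_apply i) hA,
      offDiagonalIntegral_apply μ P hs (measurable_pi_apply i hA)]
    have h : ∀ r, offDiagonal μ (s r) ((fun x => x i) ⁻¹' A) = μ A := fun r => by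
      rw [← Measure.map_apply (measurable_pi_apply i) hA, (hJ r).marginal i]
    simp [h]

end

end FlowJoinings

open FlowJoinings

/-!
Suppose that an automorphism `S` conjugates the flow to its inverse. Then `S × ⋯ × S` carries the
off-diagonal joining with times `s` to the one with times `-s`, hence carries `∫ μ_{-t} dQ(t)` to
`∫ μ_t dQ(t)`. On the other hand, for the times considered here (all sums `q(ε)` over the cube, or
the multiples `0, q, …, dq`), reversing the times is the same as permuting the coordinates by
`ε ↦ 1 - ε` (or `j ↦ d - j`), up to a common shift which does not affect the joining. Convergence in
the metric is convergence on all measurable product sets, so it is compatible with both operations,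
and the two images of the limit coincide. The permuted limit is `∫ μ_{θ t} dQ(t)`. Thus
`∫ μ_t dQ(t) = ∫ μ_t d(θ_* Q)(t)`, and `Q = θ_* Q` follows once `Q` can be recovered from
`∫ μ_t dQ(t)` (`measurePreserving_of_isomorphicToInverse`).

This recovery is uniqueness of the ergodic decomposition. The joinings `μ_t` are factors of the
flow, hence ergodic, and by aperiodicity they are pairwise distinct: `μ_t` lives on a graph whose
time-differences are those of `t`. If `ρ = ∫ κ_t dQ(t)` with ergodic `κ_t`, then the conditional
expectation of the indicator of `A` on the `ρ`-almost invariant sets is `κ_t`-almost surely equal to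
`κ_t(A)`, for almost every `t` (`ae_condExp_aeInvariants_ae_eq`). It depends on `ρ` only. Letting
`A` run through a countable `π`-system generating the `σ`-algebra, the image of `Q` under the
injective measurable map `t ↦ (κ_t(A))_A` is determined by `ρ`, and by the Lusin-Souslin theorem so
is `Q` (`eq_of_bind_eq_bind_of_ergodic`).
-/

namespace FlowJoinings

open ProbabilityTheory

/-! ### Preliminaries on generating families and integrals -/

theorem exists_countable_piSystem_generateFrom (Y : Type*) [m : MeasurableSpace Y]
    [MeasurableSpace.CountablyGenerated Y] :
    ∃ 𝒜 : Set (Set Y), 𝒜.Countable ∧ IsPiSystem 𝒜 ∧ m = MeasurableSpace.generateFrom 𝒜 := by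
  refine ⟨generateSetAlgebra (MeasurableSpace.countableGeneratingSet Y),
    countable_generateSetAlgebra MeasurableSpace.countable_countableGeneratingSet,
    isSetAlgebra_generateSetAlgebra.isSetRing.isSetSemiring.isPiSystem, ?_⟩
  rw [generateFrom_generateSetAlgebra_eq, MeasurableSpace.generateFrom_countableGeneratingSet]

theorem integral_bind_kernel {Ω Y : Type*} [MeasurableSpace Ω] [MeasurableSpace Y]
    (κ : Kernel Ω Y) (Q : Measure Ω) {f : Y → ℝ} (hf : Integrable f (Q.bind κ)) :
    ∫ y, f y ∂(Q.bind κ) = ∫ t, ∫ y, f y ∂κ t ∂Q := by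
  rw [Measure.comp_eq_comp_const_apply] at hf ⊢
  rw [Kernel.integral_comp hf, Kernel.const_apply]

theorem integrable_integral_kernel {Ω Y : Type*} [MeasurableSpace Ω] [MeasurableSpace Y]
    (κ : Kernel Ω Y) (Q : Measure Ω) {f : Y → ℝ} (hf : Integrable f (Q.bind κ)) :
    Integrable (fun t => ∫ y, f y ∂κ t) Q := by
  rw [Measure.comp_eq_comp_const_apply] at hf
  simpa using hf.integral_comp

/-! ### Uniqueness of the ergodic decomposition -/

section ErgodicDecomposition

variable {Y : Type*} [MeasurableSpace Y] [AddAction ℝ Y]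

/-- The `σ`-algebra of the measurable sets which are invariant, up to `ρ`-null sets, under each
time-`s` map of the flow. -/
abbrev aeInvariants (ρ : Measure Y) : MeasurableSpace Y where
  MeasurableSet' A := MeasurableSet A ∧ ∀ s : ℝ, (s +ᵥ ·) ⁻¹' A =ᵐ[ρ] A
  measurableSet_empty := ⟨.empty, fun s => by simp⟩
  measurableSet_compl A hA := ⟨hA.1.compl, fun s => (hA.2 s).compl⟩
  measurableSet_iUnion A hA := ⟨.iUnion fun n => (hA n).1, fun s => by
    rw [Set.preimage_iUnion]
    exact Filter.EventuallyEq.countable_iUnion fun n => (hA n).2 s⟩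

theorem aeInvariants_le (ρ : Measure Y) : aeInvariants ρ ≤ ‹MeasurableSpace Y› :=
  fun _ hA => hA.1

/-- The density of one invariant measure with respect to another is invariant. -/
theorem measurable_aeInvariants_rnDeriv (ν ρ : Measure Y) [IsFiniteMeasure ν] [IsFiniteMeasure ρ]
    [VAddInvariantMeasure ℝ Y ν] [VAddInvariantMeasure ℝ Y ρ] [MeasurableConstVAdd ℝ Y] :
    Measurable[aeInvariants ρ] (ν.rnDeriv ρ) := by
  refine fun U hU => ⟨Measure.measurable_rnDeriv ν ρ hU, fun s => ?_⟩
  have h := (measurableEmbedding_const_vadd s).rnDeriv_map ν ρ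
  rw [(measurePreserving_vadd s ν).map_eq, (measurePreserving_vadd s ρ).map_eq] at h
  filter_upwards [h] with y hy
  exact congrArg (· ∈ U) hy

/-- If a set is almost surely invariant under the average of the measures `κ t`, then it is almost
surely invariant under almost every `κ t`. Each single time is clear; Fubini's theorem gives
almost every time simultaneously, and the times which work form a subgroup of `ℝ`. -/
theorem ae_forall_preimage_vadd_ae_eq [MeasurableVAdd₂ ℝ Y] {Ω : Type*} [MeasurableSpace Ω]
    (κ : Kernel Ω Y) [IsMarkovKernel κ] [∀ t, VAddInvariantMeasure ℝ Y (κ t)]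
    (Q : Measure Ω) [IsProbabilityMeasure Q] {A : Set Y} (hA : MeasurableSet A)
    (hinv : ∀ s : ℝ, (s +ᵥ ·) ⁻¹' A =ᵐ[Q.bind κ] A) :
    ∀ᵐ t ∂Q, ∀ s : ℝ, (s +ᵥ ·) ⁻¹' A =ᵐ[κ t] A := by
  have hD : MeasurableSet {p : (ℝ × Ω) × Y | ¬ (p.1.1 +ᵥ p.2 ∈ A ↔ p.2 ∈ A)} := by
    have h1 : MeasurableSet {p : (ℝ × Ω) × Y | p.1.1 +ᵥ p.2 ∈ A} :=
      (measurable_fst.fst.vadd measurable_snd) hA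
    have h2 : MeasurableSet {p : (ℝ × Ω) × Y | p.2 ∈ A} := measurable_snd hA
    exact (h1.iff h2).compl
  have hm : MeasurableSet {p : ℝ × Ω | ∀ᵐ y ∂κ p.2, (p.1 +ᵥ y ∈ A ↔ y ∈ A)} :=
    Kernel.measurable_kernel_prodMk_left (κ := κ.comap Prod.snd measurable_snd) hD
      (measurableSet_singleton 0)
  have h1 : ∀ s : ℝ, ∀ᵐ t ∂Q, ∀ᵐ y ∂κ t, (s +ᵥ y ∈ A ↔ y ∈ A) := fun s =>
    (Measure.ae_ae_of_ae_bind κ.measurable.aemeasurable (hinv s)).mono fun t ht =>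
      ht.mono fun y hy => iff_of_eq hy
  filter_upwards [(Measure.ae_ae_comm hm).1 (ae_of_all (volume : Measure ℝ) h1)] with t ht s
  -- Write `s = (s - a) + a` with both summands in the conull set of good times.
  have hsub := Measure.measurePreserving_sub_left (volume : Measure ℝ) s
  obtain ⟨a, ha, hsa⟩ := (ht.and (hsub.quasiMeasurePreserving.ae ht)).exists
  filter_upwards [ha, (measurePreserving_vadd a (κ t)).quasiMeasurePreserving.ae hsa] with y h h'
  rw [vadd_vadd, sub_add_cancel] at h'
  exact propext (h'.trans h)

/-- A function which is invariant under the average of ergodic measures is almost surely constant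
for almost every one of them. -/
theorem ae_exists_ae_eq_const [MeasurableVAdd₂ ℝ Y] {Ω : Type*} [MeasurableSpace Ω]
    (κ : Kernel Ω Y) [IsMarkovKernel κ] [∀ t, ErgodicVAdd ℝ Y (κ t)]
    (Q : Measure Ω) [IsProbabilityMeasure Q] [VAddInvariantMeasure ℝ Y (Q.bind κ)] {F : Y → ℝ}
    (hF : Measurable[aeInvariants (Q.bind κ)] F) :
    ∀ᵐ t ∂Q, ∃ c, F =ᵐ[κ t] fun _ => c := by
  have h : ∀ᵐ t ∂Q, ∀ r : ℚ, EventuallyConst (F ⁻¹' Set.Iio (r : ℝ)) (ae (κ t)) := by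
    refine ae_all_iff.2 fun r => ?_
    obtain ⟨hm, hinv⟩ := hF (measurableSet_Iio (a := (r : ℝ)))
    filter_upwards [ae_forall_preimage_vadd_ae_eq κ Q hm hinv] with t ht
    exact ErgodicVAdd.aeconst_of_forall_preimage_vadd_ae_eq hm ht
  have hsep : HasCountableSeparatingOn ℝ (fun U => ∃ r : ℚ, U = Set.Iio (r : ℝ)) Set.univ := by
    refine ⟨Set.range fun r : ℚ => Set.Iio (r : ℝ), Set.countable_range _, ?_, ?_⟩
    · rintro _ ⟨r, rfl⟩
      exact ⟨r, rfl⟩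
    · intro x _ y _ hxy
      by_contra hne
      rcases lt_or_gt_of_ne hne with hlt | hlt <;> obtain ⟨r, h1, h2⟩ := exists_rat_btwn hlt
      · exact lt_asymm h2 ((hxy _ ⟨r, rfl⟩).1 h1)
      · exact lt_asymm h2 ((hxy _ ⟨r, rfl⟩).2 h1)
  filter_upwards [h] with t ht
  refine exists_eventuallyEq_const_of_forall_separating
    (fun U => ∃ r : ℚ, U = Set.Iio (r : ℝ)) ?_
  rintro _ ⟨r, rfl⟩
  rcases eventuallyConst_set.1 (ht r) with h | h
  · exact Or.inl h
  · exact Or.inr h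

theorem vaddInvariantMeasure_bind [MeasurableConstVAdd ℝ Y] {Ω : Type*} [MeasurableSpace Ω]
    (κ : Kernel Ω Y) [∀ t, VAddInvariantMeasure ℝ Y (κ t)] (Q : Measure Ω) :
    VAddInvariantMeasure ℝ Y (Q.bind κ) where
  measure_preimage_vadd s A hA := by
    rw [Measure.bind_apply (measurable_const_vadd s hA) κ.measurable.aemeasurable,
      Measure.bind_apply hA κ.measurable.aemeasurable]
    exact lintegral_congr fun t => measure_preimage_vadd_of_nullMeasurableSet hA.nullMeasurableSet s

/-- Conditioning the average `Q.bind κ` of ergodic measures on its invariant sets recovers the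
measures `κ t`. The point is that for each `D ⊆ Ω` the average of the `κ t`, `t ∈ D`, has an
invariant density with respect to `Q.bind κ`, so that replacing the indicator of `A` by its
conditional expectation does not change the integral over `D`. -/
theorem ae_condExp_aeInvariants_ae_eq [MeasurableVAdd₂ ℝ Y] {Ω : Type*} [MeasurableSpace Ω]
    (κ : Kernel Ω Y) [IsMarkovKernel κ] [∀ t, ErgodicVAdd ℝ Y (κ t)]
    (Q : Measure Ω) [IsProbabilityMeasure Q] [VAddInvariantMeasure ℝ Y (Q.bind κ)] {A : Set Y}
    (hA : MeasurableSet A) :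
    ∀ᵐ t ∂Q, (Q.bind κ)[A.indicator fun _ => (1 : ℝ) | aeInvariants (Q.bind κ)] =ᵐ[κ t]
      fun _ => (κ t).real A := by
  set ρ := Q.bind κ with hρ
  have : IsProbabilityMeasure ρ := by rw [hρ]; infer_instance
  have hle := aeInvariants_le ρ
  set f : Y → ℝ := A.indicator fun _ => (1 : ℝ) with hf_def
  set F := ρ[f | aeInvariants ρ] with hF_def
  have hf : Integrable f ρ := (integrable_const 1).indicator hA
  have hF : Integrable F ρ := integrable_condExp
  have hint : ∀ D, MeasurableSet D → ∫ t in D, ∫ y, F y ∂κ t ∂Q = ∫ t in D, ∫ y, f y ∂κ t ∂Q := by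
    intro D hD
    have := vaddInvariantMeasure_bind κ (Q.restrict D)
    set ν := (Q.restrict D).bind κ with hν
    have : IsFiniteMeasure ν := by rw [hν]; infer_instance
    have hνρ : ν ≤ ρ := by
      refine Measure.le_iff.2 fun C hC => ?_
      rw [hν, hρ, Measure.bind_apply hC κ.measurable.aemeasurable,
        Measure.bind_apply hC κ.measurable.aemeasurable]
      exact lintegral_mono' Measure.restrict_le_self le_rfl
    have hac : ν ≪ ρ := hνρ.absolutelyContinuous
    rw [← integral_bind_kernel κ _ (hF.mono_measure hνρ),
      ← integral_bind_kernel κ _ (hf.mono_measure hνρ), ← integral_rnDeriv_smul hac,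
      ← integral_rnDeriv_smul hac]
    have hw : Measurable[aeInvariants ρ] fun y => (ν.rnDeriv ρ y).toReal :=
      (measurable_aeInvariants_rnDeriv ν ρ).ennreal_toReal
    have hwf : Integrable (fun y => (ν.rnDeriv ρ y).toReal * f y) ρ :=
      (integrable_rnDeriv_smul_iff hac).2 (hf.mono_measure hνρ)
    calc ∫ y, (ν.rnDeriv ρ y).toReal • F y ∂ρ
        = ∫ y, (ρ[fun y => (ν.rnDeriv ρ y).toReal * f y | aeInvariants ρ]) y ∂ρ :=
          (integral_congr_ae
            (condExp_mul_of_stronglyMeasurable_left hw.stronglyMeasurable hwf hf)).symm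
      _ = ∫ y, (ν.rnDeriv ρ y).toReal • f y ∂ρ := integral_condExp hle
  have hmean : ∀ᵐ t ∂Q, ∫ y, F y ∂κ t = ∫ y, f y ∂κ t :=
    ae_eq_of_forall_setIntegral_eq_of_sigmaFinite
      (fun D _ _ => (integrable_integral_kernel κ Q hF).integrableOn)
      (fun D _ _ => (integrable_integral_kernel κ Q hf).integrableOn) fun D hD _ => hint D hD
  filter_upwards [hmean, ae_exists_ae_eq_const κ Q (F := F) stronglyMeasurable_condExp.measurable]
    with t ht ⟨c, hc⟩
  filter_upwards [hc] with y hy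
  rw [integral_congr_ae hc, hf_def, integral_indicator_const _ hA] at ht
  simpa [hy] using ht

/-- Uniqueness of the ergodic decomposition of an invariant measure, for decompositions which
are parametrized by the same injective family of ergodic measures. -/
theorem eq_of_bind_eq_bind_of_ergodic [MeasurableVAdd₂ ℝ Y] [MeasurableSpace.CountablyGenerated Y]
    {Ω : Type*} [MeasurableSpace Ω] [StandardBorelSpace Ω]
    (κ : Kernel Ω Y) [IsMarkovKernel κ] [∀ t, ErgodicVAdd ℝ Y (κ t)] (hκ : Function.Injective κ)
    (Q Q' : Measure Ω) [IsProbabilityMeasure Q] [IsProbabilityMeasure Q']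
    (h : Q.bind κ = Q'.bind κ) : Q = Q' := by
  obtain ⟨𝒜, hc, hpi, hgen⟩ := exists_countable_piSystem_generateFrom Y
  have : Countable 𝒜 := hc.to_subtype
  have hm : ∀ A : 𝒜, MeasurableSet (A : Set Y) := fun A => by
    rw [hgen]; exact MeasurableSpace.measurableSet_generateFrom A.2
  have hinv := vaddInvariantMeasure_bind κ Q
  let Φ : Y → 𝒜 → ℝ := fun y A =>
    ((Q.bind κ)[(A : Set Y).indicator fun _ => (1 : ℝ) | aeInvariants (Q.bind κ)]) y
  have hΦ : Measurable Φ := measurable_pi_lambda _ fun A =>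
    stronglyMeasurable_condExp.measurable.mono (aeInvariants_le _) le_rfl
  let g : Ω → 𝒜 → ℝ := fun t A => (κ t).real A
  have hg : Measurable g := measurable_pi_lambda _ fun A =>
    (κ.measurable_coe (hm A)).ennreal_toReal
  have hginj : Function.Injective g := fun t t' htt' => by
    refine hκ (ext_of_generate_finite 𝒜 hgen hpi (fun A hA => ?_) (by simp))
    have := congrFun htt' ⟨A, hA⟩
    simpa [g, measureReal_def, ENNReal.toReal_eq_toReal_iff'] using this
  -- `Φ` reads off `g t` from `κ t`-almost every point, whichever of `Q`, `Q'` governs `t`.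
  have key : ∀ P : Measure Ω, IsProbabilityMeasure P → P.bind κ = Q.bind κ →
      P.map g = (Q.bind κ).map Φ := by
    intro P hP hPQ
    have hPi := vaddInvariantMeasure_bind κ P
    have hae : ∀ᵐ t ∂P, ∀ᵐ y ∂κ t, Φ y = g t := by
      have h1 : ∀ᵐ t ∂P, ∀ A : 𝒜, ∀ᵐ y ∂κ t, Φ y A = g t A := by
        refine ae_all_iff.2 fun A => ?_
        have h2 := ae_condExp_aeInvariants_ae_eq κ P (hm A)
        simp only [hPQ] at h2
        exact h2
      filter_upwards [h1] with t ht
      filter_upwards [ae_all_iff.2 ht] with y hy using funext hy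
    ext U hU
    rw [Measure.map_apply hg hU, Measure.map_apply hΦ hU, ← hPQ,
      Measure.bind_apply (hΦ hU) κ.measurable.aemeasurable, ← lintegral_indicator_one (hg hU)]
    refine lintegral_congr_ae (hae.mono fun t ht => ?_)
    have : κ t (Φ ⁻¹' U) = κ t {_y | g t ∈ U} :=
      measure_congr (ht.mono fun y hy => congrArg (· ∈ U) hy)
    by_cases hU' : g t ∈ U <;> simp [this, hU', Set.indicator]
  have hmap : Q.map g = Q'.map g :=
    (key Q inferInstance rfl).trans (key Q' inferInstance h.symm).symm
  have hemb := hg.measurableEmbedding hginj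
  rw [← hemb.comap_map Q, ← hemb.comap_map Q', hmap]

end ErgodicDecomposition

/-! ### Self-joinings of a flow -/

section Joinings

variable {X : Type*} [MeasurableSpace X] [AddAction ℝ X]

instance measurableVAdd₂_pi [MeasurableVAdd₂ ℝ X] {ι : Type*} : MeasurableVAdd₂ ℝ (ι → X) where
  measurable_vadd := measurable_pi_lambda _ fun i =>
    measurable_fst.vadd ((measurable_pi_apply i).comp measurable_snd)

/-- An off-diagonal joining is a factor of the flow on `(X, μ)`, hence ergodic. -/
theorem ergodicVAdd_offDiagonal [MeasurableVAdd₂ ℝ X] (μ : Measure X) [ErgodicVAdd ℝ X μ]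
    {ι : Type*} (s : ι → ℝ) : ErgodicVAdd ℝ (ι → X) (offDiagonal μ s) := by
  have hm : Measurable fun (x : X) (i : ι) => s i +ᵥ x :=
    measurable_pi_lambda _ fun i => measurable_const_vadd (s i)
  have hcomm : ∀ (t : ℝ) (x : X),
      (t +ᵥ fun i => s i +ᵥ x : ι → X) = fun i => s i +ᵥ (t +ᵥ x) := fun t x => by
    funext i
    simp only [Pi.vadd_apply, vadd_vadd, add_comm]
  refine { measure_preimage_vadd := fun t A hA => ?_,
           aeconst_of_forall_preimage_vadd_ae_eq := fun {A} hA hinv => ?_ }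
  · rw [offDiagonal, Measure.map_apply hm (measurable_const_vadd t hA), Measure.map_apply hm hA]
    rw [← measure_preimage_vadd_of_nullMeasurableSet (μ := μ) (hm hA).nullMeasurableSet t]
    congr 1
    ext x
    simp only [Set.mem_preimage, hcomm]
  · have hmp : MeasurePreserving (fun (x : X) (i : ι) => s i +ᵥ x) μ (offDiagonal μ s) := ⟨hm, rfl⟩
    refine (hmp.aeconst_preimage hA.nullMeasurableSet).1
      (ErgodicVAdd.aeconst_of_forall_preimage_vadd_ae_eq (G := ℝ) (hm hA) fun t => ?_)
    filter_upwards [hmp.quasiMeasurePreserving.ae (hinv t)] with x hx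
    have hx' : ((t +ᵥ fun i => s i +ᵥ x : ι → X) ∈ A) = ((fun i => s i +ᵥ x) ∈ A) := hx
    rw [hcomm] at hx'
    exact hx'

/-- Two joinings differ on a product set by at most the total change of its sides. -/
theorem IsSelfJoining.abs_sub_le {μ : Measure X} {ι : Type*} [Fintype ι] {ρ : Measure (ι → X)}
    (hρ : IsSelfJoining μ ρ) {A C : ι → Set X} (hA : ∀ i, MeasurableSet (A i))
    (hC : ∀ i, MeasurableSet (C i)) :
    |ρ.real (Set.univ.pi A) - ρ.real (Set.univ.pi C)| ≤ ∑ i, μ.real (symmDiff (A i) (C i)) := by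
  have := hρ.isProbabilityMeasure
  calc |ρ.real (Set.univ.pi A) - ρ.real (Set.univ.pi C)|
      ≤ ρ.real (symmDiff (Set.univ.pi A) (Set.univ.pi C)) :=
        abs_measureReal_sub_le_measureReal_symmDiff (MeasurableSet.univ_pi hA).nullMeasurableSet
          (MeasurableSet.univ_pi hC).nullMeasurableSet
    _ ≤ ρ.real (⋃ i, (fun x : ι → X => x i) ⁻¹' symmDiff (A i) (C i)) := by
        refine measureReal_mono fun x hx => ?_
        simp only [Set.mem_symmDiff, Set.mem_univ_pi, not_forall, Set.mem_iUnion,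
          Set.mem_preimage] at hx ⊢
        rcases hx with ⟨h, i, hi⟩ | ⟨h, i, hi⟩
        · exact ⟨i, Or.inl ⟨h i, hi⟩⟩
        · exact ⟨i, Or.inr ⟨h i, hi⟩⟩
    _ ≤ ∑ i, ρ.real ((fun x : ι → X => x i) ⁻¹' symmDiff (A i) (C i)) :=
        measureReal_iUnion_fintype_le _
    _ = ∑ i, μ.real (symmDiff (A i) (C i)) := by
        refine Finset.sum_congr rfl fun i _ => ?_
        rw [measureReal_def, measureReal_def, ← hρ.marginal i,
          Measure.map_apply (measurable_pi_apply i) ((hA i).symmDiff (hC i))]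

/-- Convergence of joinings in the metric is convergence on all measurable product sets. -/
theorem tendsto_pi_of_tendsto_joiningDist {μ : Measure X} [IsFiniteMeasure μ] {B : ℕ → Set X}
    (hB : μ.MeasureDense (Set.range B)) {ι : Type*} [Fintype ι] {ρ : ℕ → Measure (ι → X)}
    {ρ' : Measure (ι → X)} (hρ : ∀ n, IsSelfJoining μ (ρ n)) (hρ' : IsSelfJoining μ ρ')
    (h : Tendsto (fun n => joiningDist B (ρ n) ρ') atTop (𝓝 0)) {A : ι → Set X}
    (hA : ∀ i, MeasurableSet (A i)) :
    Tendsto (fun n => (ρ n).real (Set.univ.pi A)) atTop (𝓝 (ρ'.real (Set.univ.pi A))) := by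
  have hbase : ∀ m : ι → ℕ, Tendsto (fun n => |(ρ n).real (Set.univ.pi fun i => B (m i)) -
      ρ'.real (Set.univ.pi fun i => B (m i))|) atTop (𝓝 0) := by
    intro m
    have hc : (0 : ℝ) < (1 / 2 : ℝ) ^ (∑ i, m i) := by positivity
    have h1 := tendsto_of_tendsto_of_tendsto_of_le_of_le tendsto_const_nhds h
      (fun _ => zero_le) fun n => ENNReal.le_tsum (f := fun m : ι → ℕ =>
        ENNReal.ofReal ((1 / 2 : ℝ) ^ (∑ i, m i) *
          |(ρ n).real (Set.univ.pi fun i => B (m i)) -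
            ρ'.real (Set.univ.pi fun i => B (m i))|)) m
    have h2 := (ENNReal.tendsto_toReal ENNReal.zero_ne_top).comp h1
    have h3 := h2.const_mul ((1 / 2 : ℝ) ^ (∑ i, m i))⁻¹
    simp only [ENNReal.toReal_zero, mul_zero] at h3
    refine h3.congr fun n => ?_
    simp only [Function.comp_apply]
    rw [ENNReal.toReal_ofReal (by positivity), inv_mul_cancel_left₀ hc.ne']
  rw [Metric.tendsto_atTop]
  intro ε hε
  obtain ⟨δ, hδ, hδε⟩ : ∃ δ > 0, (Fintype.card ι : ℝ) * δ < ε / 3 := by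
    refine ⟨ε / 3 / (Fintype.card ι + 1), by positivity, ?_⟩
    rw [mul_div_assoc', div_lt_iff₀ (by positivity)]
    nlinarith
  have happ : ∀ i, ∃ m, μ (symmDiff (A i) (B m)) < ENNReal.ofReal δ := fun i => by
    obtain ⟨_, ⟨m, rfl⟩, hm⟩ := hB.approx (A i) (hA i) (measure_ne_top _ _) δ hδ
    exact ⟨m, hm⟩
  choose m hm using happ
  have hBm : ∀ i, MeasurableSet (B (m i)) := fun i => hB.measurable _ ⟨m i, rfl⟩
  have hsum : ∑ i, μ.real (symmDiff (A i) (B (m i))) < ε / 3 := by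
    refine lt_of_le_of_lt (Finset.sum_le_sum fun i _ =>
      (ENNReal.toReal_le_of_le_ofReal hδ.le (hm i).le : _ ≤ δ)) ?_
    simpa using hδε
  obtain ⟨N, hN⟩ := Metric.tendsto_atTop.1 (hbase m) (ε / 3) (by positivity)
  refine ⟨N, fun n hn => ?_⟩
  have h1 := (abs_le.1 (((hρ n).abs_sub_le hA hBm).trans hsum.le))
  have h2 := (abs_le.1 ((hρ'.abs_sub_le hA hBm).trans hsum.le))
  have h3 := hN n hn
  rw [Real.dist_eq, sub_zero, abs_abs] at h3
  have h3 := abs_lt.1 h3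
  rw [Real.dist_eq, abs_lt]
  constructor <;> linarith [h1.1, h1.2, h2.1, h2.2, h3.1, h3.2]

/-- Finite measures on a finite product agree once they agree on measurable product sets. -/
theorem ext_of_forall_real_pi_eq {ι X : Type*} [Finite ι] [MeasurableSpace X]
    {ρ ρ' : Measure (ι → X)} [IsFiniteMeasure ρ] [IsFiniteMeasure ρ']
    (h : ∀ A : ι → Set X, (∀ i, MeasurableSet (A i)) →
      ρ.real (Set.univ.pi A) = ρ'.real (Set.univ.pi A)) : ρ = ρ' := by
  have h' : ∀ A : ι → Set X, (∀ i, MeasurableSet (A i)) →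
      ρ (Set.univ.pi A) = ρ' (Set.univ.pi A) := fun A hA => by
    have := h A hA
    rwa [measureReal_def, measureReal_def,
      ENNReal.toReal_eq_toReal_iff' (measure_ne_top _ _) (measure_ne_top _ _)] at this
  refine ext_of_generate_finite _ generateFrom_pi.symm isPiSystem_pi ?_ ?_
  · rintro _ ⟨A, hA, rfl⟩
    exact h' A fun i => hA i (Set.mem_univ i)
  · simpa using h' (fun _ => Set.univ) fun _ => .univ

/-- Shifting all the times of an off-diagonal joining by a constant does not change it. -/
theorem offDiagonal_const_add [MeasurableVAdd₂ ℝ X] (μ : Measure X) [VAddInvariantMeasure ℝ X μ]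
    {ι : Type*} (c : ℝ) (s : ι → ℝ) : offDiagonal μ (fun i => c + s i) = offDiagonal μ s := by
  have hm : Measurable fun (x : X) (i : ι) => s i +ᵥ x :=
    measurable_pi_lambda _ fun i => measurable_const_vadd (s i)
  rw [offDiagonal, offDiagonal, ← (measurePreserving_vadd c μ).map_eq,
    Measure.map_map hm (measurable_const_vadd c), (measurePreserving_vadd c μ).map_eq]
  congr 1
  funext x i
  simp only [Function.comp_apply, vadd_vadd, add_comm]

theorem map_reindex_offDiagonal [MeasurableVAdd₂ ℝ X] (μ : Measure X) {ι ι' : Type*} (σ : ι' → ι)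
    (s : ι → ℝ) :
    (offDiagonal μ s).map (fun x i => x (σ i)) = offDiagonal μ fun i => s (σ i) := by
  rw [offDiagonal, Measure.map_map (measurable_pi_lambda _ fun i => measurable_pi_apply _)
    (measurable_pi_lambda _ fun i => measurable_const_vadd (s i))]
  rfl

/-- A conjugacy to the inverse flow reverses the times of off-diagonal joinings. -/
theorem ConjugatesToInverse.map_offDiagonal [MeasurableVAdd₂ ℝ X] {μ : Measure X} {S : X → X}
    (hS : ConjugatesToInverse μ S) {ι : Type*} [Countable ι] (s : ι → ℝ) :
    (offDiagonal μ s).map (fun x i => S (x i)) = offDiagonal μ (-s) := by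
  have hm : ∀ s : ι → ℝ, Measurable fun (x : X) (i : ι) => s i +ᵥ x := fun s =>
    measurable_pi_lambda _ fun i => measurable_const_vadd (s i)
  have hSm := hS.1.measurable
  have hSg : Measurable fun (x : ι → X) i => S (x i) :=
    measurable_pi_lambda _ fun i => hSm.comp (measurable_pi_apply i)
  rw [offDiagonal, Measure.map_map hSg (hm s), offDiagonal]
  conv_rhs => rw [← hS.1.map_eq, Measure.map_map (hm _) hSm]
  refine Measure.map_congr ?_
  filter_upwards [ae_all_iff.2 fun i => hS.2.2 (s i)] with x hx
  funext i
  exact hx i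

theorem map_offDiagonalIntegral [MeasurableVAdd₂ ℝ X] (μ : Measure X) [SFinite μ]
    {ι ι' Ω : Type*} [MeasurableSpace Ω] (P : Measure Ω) {s : Ω → ι → ℝ} {s' : Ω → ι' → ℝ}
    (hs : Measurable s) (hs' : Measurable s') {g : (ι → X) → ι' → X} (hg : Measurable g)
    (h : ∀ t, (offDiagonal μ (s t)).map g = offDiagonal μ (s' t)) :
    (offDiagonalIntegral μ P s).map g = offDiagonalIntegral μ P s' := by
  ext A hA
  rw [Measure.map_apply hg hA, offDiagonalIntegral_apply μ P hs (hg hA),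
    offDiagonalIntegral_apply μ P hs' hA]
  exact lintegral_congr fun t => by rw [← h t, Measure.map_apply hg hA]

/-- By aperiodicity, the relative times of an off-diagonal joining can be recovered from it: almost
every point of the joining lies on the graph of the corresponding time-`t` map. -/
theorem Aperiodic.sub_eq_sub_of_offDiagonal_eq [StandardBorelSpace X] [MeasurableVAdd₂ ℝ X]
    {μ : Measure X} [NeZero μ] (hT : Aperiodic μ) {ι : Type*} {s s' : ι → ℝ}
    (h : offDiagonal μ s = offDiagonal μ s') (i j : ι) : s i - s j = s' i - s' j := by
  have hm : ∀ s : ι → ℝ, Measurable fun (x : X) (i : ι) => s i +ᵥ x := fun s =>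
    measurable_pi_lambda _ fun i => measurable_const_vadd (s i)
  have hG : MeasurableSet {z : ι → X | z i = (s i - s j) +ᵥ z j} :=
    measurableSet_eq_fun (measurable_pi_apply i)
      ((measurable_const_vadd (s i - s j)).comp (measurable_pi_apply j))
  have h1 : ∀ᵐ z ∂offDiagonal μ s, z i = (s i - s j) +ᵥ z j := by
    refine (ae_map_iff (hm s).aemeasurable hG).2 (ae_of_all _ fun x => ?_)
    rw [vadd_vadd, sub_add_cancel]
  rw [h] at h1
  have h2 : ∀ᵐ x ∂μ, s' i +ᵥ x = (s i - s j) +ᵥ (s' j +ᵥ x) :=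
    (ae_map_iff (hm s').aemeasurable hG).1 h1
  by_contra hne
  have h3 : ∀ᵐ x ∂μ, ¬ ((s i - s j) - (s' i - s' j)) +ᵥ x = x := by
    have := hT _ (sub_ne_zero.2 hne)
    exact measure_eq_zero_iff_ae_notMem.1 this
  obtain ⟨x, hx, hx'⟩ := (h2.and h3).exists
  refine hx' (vadd_left_cancel (s' i) ?_)
  rw [vadd_vadd]
  conv_rhs => rw [hx, vadd_vadd]
  congr 1
  ring

/-- Uniqueness of the representation of a joining as an integral of off-diagonal joinings, for
a parametrization `e` of relative times which is injective and vanishes at the index `i₀`. -/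
theorem eq_of_offDiagonalIntegral_eq [StandardBorelSpace X] [MeasurableVAdd₂ ℝ X]
    (μ : Measure X) [IsProbabilityMeasure μ] [ErgodicVAdd ℝ X μ] (hT : Aperiodic μ)
    {ι Ω : Type*} [Finite ι] [MeasurableSpace Ω] [StandardBorelSpace Ω] {e : Ω → ι → ℝ}
    (he : Measurable e) (hinj : Function.Injective e) (i₀ : ι) (hi₀ : ∀ t, e t i₀ = 0)
    (P P' : Measure Ω) [IsProbabilityMeasure P] [IsProbabilityMeasure P']
    (h : offDiagonalIntegral μ P e = offDiagonalIntegral μ P' e) : P = P' := by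
  let κ : Kernel Ω (ι → X) := ⟨fun t => offDiagonal μ (e t), measurable_offDiagonal μ he⟩
  have : IsMarkovKernel κ := ⟨fun t => (isSelfJoining_offDiagonal μ (e t)).isProbabilityMeasure⟩
  have : ∀ t, ErgodicVAdd ℝ (ι → X) (κ t) := fun t => ergodicVAdd_offDiagonal μ (e t)
  refine eq_of_bind_eq_bind_of_ergodic κ (fun t t' htt' => hinj (funext fun i => ?_)) P P' h
  have := hT.sub_eq_sub_of_offDiagonal_eq htt' i i₀
  simpa [hi₀] using this

/-- Suppose that reversing the times `a n` amounts, up to a common shift, to permuting the indices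
by `σ`. If the flow is isomorphic to its inverse, then every limit of the off-diagonal joinings
given by `a n` is symmetric: its mixing measure `Q` is invariant under the induced map `θ`. -/
theorem measurePreserving_of_isomorphicToInverse [StandardBorelSpace X] [MeasurableVAdd₂ ℝ X]
    {μ : Measure X} [IsProbabilityMeasure μ] [ErgodicVAdd ℝ X μ] (hT : Aperiodic μ)
    {B : ℕ → Set X} (hB : μ.MeasureDense (Set.range B)) (hinv : IsomorphicToInverse μ)
    {ι Ω : Type*} [Fintype ι] [MeasurableSpace Ω] [StandardBorelSpace Ω] {e : Ω → ι → ℝ}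
    (he : Measurable e) (hinj : Function.Injective e) (i₀ : ι) (hi₀ : ∀ t, e t i₀ = 0)
    (a : ℕ → ι → ℝ) (σ : Equiv.Perm ι) (c : ℕ → ℝ) (hσ : ∀ n i, a n (σ i) = c n - a n i)
    {θ : Ω → Ω} (hθ : Measurable θ) (heθ : ∀ t i, e (θ t) i = e t (σ i₀) - e t (σ i))
    (Q : Measure Ω) [IsProbabilityMeasure Q]
    (hlim : Tendsto (fun n => joiningDist B (offDiagonal μ (a n))
      (offDiagonalIntegral μ Q fun t => -e t)) atTop (𝓝 0)) :
    MeasurePreserving θ Q Q := by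
  obtain ⟨S, hS⟩ := hinv
  have hne : Measurable fun t => -e t := he.neg
  have hSg : Measurable fun (x : ι → X) i => S (x i) :=
    measurable_pi_lambda _ fun i => hS.1.measurable.comp (measurable_pi_apply i)
  have hσg : Measurable fun (x : ι → X) i => x (σ i) :=
    measurable_pi_lambda _ fun i => measurable_pi_apply _
  have heθm : Measurable fun t => e (θ t) := he.comp hθ
  set ρ := offDiagonalIntegral μ Q fun t => -e t with hρ
  have hρJ : IsSelfJoining μ ρ := isSelfJoining_offDiagonalIntegral μ Q hne
  have := hρJ.isProbabilityMeasure
  have hconv := fun A hA => tendsto_pi_of_tendsto_joiningDist hB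
    (fun n => isSelfJoining_offDiagonal μ (a n)) hρJ hlim (A := A) hA
  have hSρ : ρ.map (fun x i => S (x i)) = offDiagonalIntegral μ Q e :=
    map_offDiagonalIntegral μ Q hne he hSg fun t => by simp [hS.map_offDiagonal]
  have hσρ : ρ.map (fun x i => x (σ i)) = offDiagonalIntegral μ Q fun t => e (θ t) :=
    map_offDiagonalIntegral μ Q hne heθm hσg fun t => by
      rw [map_reindex_offDiagonal, ← offDiagonal_const_add μ (e t (σ i₀))]
      congr 1
      funext i
      simp [heθ, sub_eq_add_neg]
  have hprelim : ∀ n, (offDiagonal μ (a n)).map (fun x i => S (x i)) =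
      (offDiagonal μ (a n)).map (fun x i => x (σ i)) := fun n => by
    rw [hS.map_offDiagonal, map_reindex_offDiagonal, ← offDiagonal_const_add μ (c n)]
    congr 1
    funext i
    simp [hσ, sub_eq_add_neg]
  have hSσ : ρ.map (fun x i => S (x i)) = ρ.map (fun x i => x (σ i)) := by
    have := Measure.isProbabilityMeasure_map (μ := ρ) hSg.aemeasurable
    have := Measure.isProbabilityMeasure_map (μ := ρ) hσg.aemeasurable
    refine ext_of_forall_real_pi_eq fun A hA => ?_
    have hpS : (fun (x : ι → X) i => S (x i)) ⁻¹' Set.univ.pi A =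
        Set.univ.pi fun i => S ⁻¹' A i := by
      ext x
      simp
    have hpσ : (fun (x : ι → X) i => x (σ i)) ⁻¹' Set.univ.pi A =
        Set.univ.pi fun i => A (σ.symm i) := by
      ext x
      simp only [Set.mem_preimage, Set.mem_univ_pi]
      exact ⟨fun h i => by simpa using h (σ.symm i), fun h i => by simpa using h (σ i)⟩
    have hApi := MeasurableSet.univ_pi hA
    rw [map_measureReal_apply hSg hApi, map_measureReal_apply hσg hApi, hpS, hpσ]
    -- Both sides are limits of the same sequence: the two images of `offDiagonal μ (a n)` agree.
    refine tendsto_nhds_unique (hconv _ fun i => hS.1.measurable (hA i)) ?_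
    refine (hconv _ fun i => hA (σ.symm i)).congr fun n => ?_
    rw [← hpS, ← hpσ, ← map_measureReal_apply hSg hApi, ← map_measureReal_apply hσg hApi,
      hprelim]
  have hQ : offDiagonalIntegral μ Q e = offDiagonalIntegral μ (Q.map θ) e := by
    rw [← hSρ, hSσ, hσρ]
    ext A hA
    rw [offDiagonalIntegral_apply μ Q heθm hA, offDiagonalIntegral_apply μ _ he hA]
    exact (lintegral_map ((Measure.measurable_coe hA).comp (measurable_offDiagonal μ he)) hθ).symm
  have := Measure.isProbabilityMeasure_map (μ := Q) hθ.aemeasurable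
  exact ⟨hθ, (eq_of_offDiagonalIntegral_eq μ hT he hinj i₀ hi₀ Q (Q.map θ) hQ).symm⟩

end Joinings

/-! ### The reflections of the cube and of an arithmetic progression -/

section Parametrizations

theorem extendZero_zero {d : ℕ} (t : PuncturedCube d → ℝ) :
    extendZero t (fun _ => false) = 0 := by
  simp [extendZero]

theorem extendZero_coe {d : ℕ} (t : PuncturedCube d → ℝ) (ε : PuncturedCube d) :
    extendZero t ε.1 = t ε := by
  simp [extendZero, ε.2]

theorem extendZero_neg {d : ℕ} (t : PuncturedCube d → ℝ) : extendZero (-t) = -extendZero t := by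
  funext ε
  by_cases h : ε ≠ fun _ => false <;> simp [extendZero, h]

theorem extendZero_injective {d : ℕ} : Function.Injective (extendZero (d := d)) :=
  fun t t' h => funext fun ε => by rw [← extendZero_coe t, h, extendZero_coe]

theorem extendZero_finiteSums {d : ℕ} (q : Fin d → ℝ) (ε : Cube d) :
    extendZero (finiteSums q) ε = ∑ i, if ε i then q i else 0 := by
  by_cases h : ε = fun _ => false <;> simp [extendZero, finiteSums, h]

/-- The reflection `ε ↦ 1 - ε` of the cube. -/
def cubeFlip (d : ℕ) : Equiv.Perm (Cube d) :=
  Function.Involutive.toPerm (fun ε i => !ε i) fun ε => by simp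

@[simp]
theorem cubeFlip_apply {d : ℕ} (ε : Cube d) (i : Fin d) : cubeFlip d ε i = !ε i := rfl

theorem extendZero_thetaBar {d : ℕ} (t : PuncturedCube d → ℝ) (ε : Cube d) :
    extendZero (thetaBar t) ε =
      extendZero t (cubeFlip d fun _ => false) - extendZero t (cubeFlip d ε) := by
  by_cases h : ε = fun _ => false
  · rw [h, extendZero_zero, sub_self]
  · exact extendZero_coe (thetaBar t) ⟨ε, h⟩

theorem appendZero_neg {d : ℕ} (t : Fin d → ℝ) : appendZero (-t) = -appendZero t := by
  funext j
  induction j using Fin.lastCases <;> simp [appendZero]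

theorem appendZero_injective {d : ℕ} : Function.Injective (appendZero (d := d)) :=
  fun t t' h => funext fun j => by simpa [appendZero] using congrFun h j.castSucc

theorem appendZero_theta {d : ℕ} (t : Fin d → ℝ) (j : Fin (d + 1)) :
    appendZero (theta t) j =
      appendZero t (Fin.revPerm (Fin.last d)) - appendZero t (Fin.revPerm j) := by
  induction j using Fin.lastCases with
  | last => simp [appendZero]
  | cast j =>
    have hd : 0 < d := j.pos
    have h0 : Fin.rev (Fin.last d) = Fin.castSucc ⟨0, hd⟩ := by ext; simp
    rw [Fin.revPerm_apply, Fin.revPerm_apply, h0]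
    simp only [appendZero, Fin.snoc_castSucc, theta]
    by_cases hj : (j : ℕ) = 0
    · have h1 : Fin.rev j.castSucc = Fin.last d := by ext; simp [Fin.val_rev, hj]
      rw [h1, Fin.snoc_last, dif_pos hj, sub_zero]
      exact congrArg t (Fin.ext hj)
    · have h1 : Fin.rev j.castSucc = Fin.castSucc ⟨d - j, by omega⟩ := by
        ext; simp [Fin.val_rev]
      rw [h1, Fin.snoc_castSucc, dif_neg hj]

end Parametrizations

end FlowJoinings


theorem proposition3 {X : Type*} [MeasurableSpace X] [StandardBorelSpace X]
    (μ : Measure X) [IsProbabilityMeasure μ]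
    [AddAction ℝ X] [MeasurableVAdd₂ ℝ X] [ErgodicVAdd ℝ X μ] (hT : Aperiodic μ)
    (B : ℕ → Set X) (hB : μ.MeasureDense (Set.range B)) :
    (∀ (d : ℕ) (q : ℕ → Fin d → ℝ) (Q : Measure (PuncturedCube d → ℝ)) [IsProbabilityMeasure Q],
      Tendsto (fun n => joiningDist B (offDiagonal μ (extendZero (finiteSums (q n))))
        (offDiagonalIntegral μ Q fun t => extendZero (-t))) atTop (𝓝 0) →
      ¬ MeasurePreserving thetaBar Q Q →
      ¬ IsomorphicToInverse μ ∧ ¬ Reversible μ) ∧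
    (∀ (d : ℕ) (q : ℕ → ℝ) (P : Measure (Fin d → ℝ)) [IsProbabilityMeasure P],
      Tendsto (fun n => joiningDist B
        (offDiagonal μ (appendZero fun j : Fin d => ((d : ℝ) - (j : ℝ)) * q n))
        (offDiagonalIntegral μ P fun t => appendZero (-t))) atTop (𝓝 0) →
      ¬ MeasurePreserving theta P P →
      ¬ IsomorphicToInverse μ) ∧
    (∀ (q : ℕ → ℝ) (Q : Measure (ℝ × ℝ)) [IsProbabilityMeasure Q],
      Tendsto (fun n => joiningDist B (offDiagonal μ ![2 * q n, q n, 0])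
        (offDiagonalIntegral μ Q fun p => ![-p.1, -p.2, 0])) atTop (𝓝 0) →
      (¬ MeasurePreserving (fun p : ℝ × ℝ => (p.1, p.1 - p.2)) Q Q →
        ¬ IsomorphicToInverse μ) ∧
      ∀ x : ℝ, Q {((0 : ℝ), x)} ≠ 0 → Q {((0 : ℝ), -x)} = 0 → ¬ IsomorphicToInverse μ) := by
  refine ⟨fun d q Q _ hlim hQ => ?_, fun d q P _ hlim hP hinv => hP ?_, fun q Q _ hlim => ?_⟩
  · have h : ¬ IsomorphicToInverse μ := fun hinv => by
      simp only [extendZero_neg] at hlim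
      refine hQ (measurePreserving_of_isomorphicToInverse hT hB hinv measurable_extendZero
        extendZero_injective (fun _ => false) extendZero_zero _ (cubeFlip d)
        (fun n => ∑ i, q n i) (fun n ε => ?_) measurable_thetaBar extendZero_thetaBar Q hlim)
      rw [extendZero_finiteSums, extendZero_finiteSums, ← Finset.sum_sub_distrib]
      refine Finset.sum_congr rfl fun i _ => ?_
      cases hε : ε i <;> simp [hε]
    exact ⟨h, fun ⟨S, hS, _⟩ => h ⟨S, hS⟩⟩
  · simp only [appendZero_neg] at hlim
    refine measurePreserving_of_isomorphicToInverse hT hB hinv measurable_appendZero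
      appendZero_injective (Fin.last d) (fun t => by simp [appendZero]) _ Fin.revPerm
      (fun n => d * q n) (fun n j => ?_) measurable_theta appendZero_theta P hlim
    have ha : ∀ j : Fin (d + 1), appendZero (fun j : Fin d => ((d : ℝ) - (j : ℝ)) * q n) j =
        ((d : ℝ) - (j : ℝ)) * q n := fun j => by
      induction j using Fin.lastCases <;> simp [appendZero]
    rw [ha, ha, Fin.revPerm_apply, Fin.val_rev, Nat.add_sub_add_right,
      Nat.cast_sub (Nat.lt_succ_iff.1 j.2)]
    ring
  · have hθ : Measurable fun p : ℝ × ℝ => (p.1, p.1 - p.2) := by fun_prop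
    have key : IsomorphicToInverse μ →
        MeasurePreserving (fun p : ℝ × ℝ => (p.1, p.1 - p.2)) Q Q := fun hinv => by
      have he : Measurable fun p : ℝ × ℝ => ![p.1, p.2, 0] := by
        refine measurable_pi_lambda _ fun j => ?_
        fin_cases j
        · exact measurable_fst
        · exact measurable_snd
        · exact measurable_const
      have hneg : ∀ p : ℝ × ℝ, ![-p.1, -p.2, 0] = -![p.1, p.2, 0] := fun p => by simp
      simp only [hneg] at hlim
      refine measurePreserving_of_isomorphicToInverse hT hB hinv he
        (fun p p' h => Prod.ext (congrFun h 0) (congrFun h 1)) 2 (fun p => rfl) _ Fin.revPerm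
        (fun n => 2 * q n) (fun n j => ?_) hθ (fun p j => ?_) Q hlim
      · fin_cases j
        · simp [Fin.rev]
        · simp [Fin.rev]; ring
        · simp [Fin.rev]
      · fin_cases j <;> simp [Fin.rev]
    refine ⟨fun h hinv => h (key hinv), fun x hx hx' hinv => hx ?_⟩
    rw [← (key hinv).measure_preimage (measurableSet_singleton _).nullMeasurableSet, ← hx']
    congr 1
    ext ⟨a, b⟩
    simp only [Set.mem_preimage, Set.mem_singleton_iff, Prod.mk.injEq]
    constructor <;> rintro ⟨rfl, h⟩ <;> exact ⟨rfl, by linarith⟩
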